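/- Let $N\ge 1$, $1<q<2$ and $\alpha>0$, and let $\Omega\subset\mathbb{R}^N$ be a nonempty open bounded set with finitely many connected components. Let $W^{1,2}_0(\Omega)$ be the closure of $C^\infty_0(\Omega)$ with respect to the norm $\|\varphi\|_{L^2(\Omega)}+\|\nabla\varphi\|_{L^2(\Omega;\mathbb{R}^N)}$, and for $\varphi\in W^{1,2}_0(\Omega)$ set \[ \mathfrak F_{q,\alpha}(\varphi)=\frac12\int_\Omega|\nabla\varphi|^2\,dx-\frac{\alpha}{q}\int_\Omega|\varphi|^q\,dx . \] Call $\lambda\in\mathbb{R}$ a critical value of $\mathfrak F_{q,\alpha}$ if $\lambda=\mathfrak F_{q,\alpha}(u)$ for some weak solution $u\in W^{1,2}_0(\Omega)$ of $-\Delta u=\alpha|u|^{q-2}u$ in $\Omega$, i.e. for some $u\in W^{1,2}_0(\Omega)$ with \[ \int_\Omega\langle\nabla u,\nabla\varphi\rangle\,dx=\alpha\int_\Omega|u|^{q-2}u\,\varphi\,dx\qquad\text{for every }\varphi\in W^{1,2}_0(\Omega). \] Let \[ \Lambda_1=\min_{\varphi\in W^{1,2}_0(\Omega)}\mathfrak F_{q,\alpha}(\varphi),\qquad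 \Lambda_2=\inf\{\lambda>\Lambda_1:\ \lambda\text{ is a critical value of }\mathfrak F_{q,\alpha}\}, \] and assume that $\Lambda_2>\Lambda_1$. Then there exist infinitely many functions $\varphi\in W^{1,2}_0(\Omega)$ that are sign-changing, i.e. neither $\varphi^+=\max\{\varphi,0\}$ nor $\varphi^-=\max\{-\varphi,0\}$ vanishes almost everywhere in $\Omega$, and that satisfy \[ \Lambda_1<\mathfrak F_{q,\alpha}(\varphi)<\Lambda_2\qquad\text{and}\qquad \mathfrak F_{q,\alpha}(\varphi^-)\ge 0 . \] -/

import Mathlib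

open MeasureTheory Filter Topology
open scoped ContDiff

namespace LaneEmden

/-- `L²(Ω)`, as a space of almost everywhere equivalence classes. -/
abbrev L2 {N : ℕ} (Ω : Set (EuclideanSpace ℝ (Fin N))) : Type :=
  Lp ℝ 2 (volume.restrict Ω)

/-- `L²(Ω; ℝ^N)`, as a space of almost everywhere equivalence classes. -/
abbrev L2Vec {N : ℕ} (Ω : Set (EuclideanSpace ℝ (Fin N))) : Type :=
  Lp (EuclideanSpace ℝ (Fin N)) 2 (volume.restrict Ω)

/-- `φ ∈ C^∞_0(Ω)`: smooth with compact support contained in `Ω`. -/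
def IsTestFunction {N : ℕ} (Ω : Set (EuclideanSpace ℝ (Fin N)))
    (φ : EuclideanSpace ℝ (Fin N) → ℝ) : Prop :=
  ContDiff ℝ ∞ φ ∧ HasCompactSupport φ ∧ tsupport φ ⊆ Ω

/-- `G` is the weak (distributional) gradient of `u` in `Ω`. -/
def IsWeakGradient {N : ℕ} (Ω : Set (EuclideanSpace ℝ (Fin N))) (u : L2 Ω) (G : L2Vec Ω) :
    Prop :=
  ∀ φ : EuclideanSpace ℝ (Fin N) → ℝ, IsTestFunction Ω φ →
    ∫ x in Ω, u x • gradient φ x = - ∫ x in Ω, φ x • G x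

/-- The Sobolev space `W^{1,2}(Ω)`. -/
def W12 {N : ℕ} (Ω : Set (EuclideanSpace ℝ (Fin N))) : Set (L2 Ω) :=
  {u | ∃ G : L2Vec Ω, IsWeakGradient Ω u G}

open Classical in
/-- The weak gradient `∇u` of `u ∈ W^{1,2}(Ω)` (and `0` if `u ∉ W^{1,2}(Ω)`). -/
noncomputable def weakGrad {N : ℕ} (Ω : Set (EuclideanSpace ℝ (Fin N))) (u : L2 Ω) : L2Vec Ω :=
  if h : ∃ G : L2Vec Ω, IsWeakGradient Ω u G then h.choose else 0

/-- Weak gradients are unique, so that `weakGrad` does not depend on a choice. -/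
theorem IsWeakGradient.unique {N : ℕ} {Ω : Set (EuclideanSpace ℝ (Fin N))} (hΩ : IsOpen Ω)
    {u : L2 Ω} {G H : L2Vec Ω} (hG : IsWeakGradient Ω u G) (hH : IsWeakGradient Ω u H) :
    G = H := by
  have hli : ∀ K : L2Vec Ω, LocallyIntegrable K (volume.restrict Ω) := fun K =>
    (Lp.memLp K).locallyIntegrable (by norm_num)
  have key : ∀ᵐ x ∂(volume.restrict Ω), x ∈ Ω → (G x - H x) = 0 := by
    refine hΩ.ae_eq_zero_of_integral_contDiff_smul_eq_zero
      (f := fun x => G x - H x)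
      (((hli G).sub (hli H)).locallyIntegrableOn Ω) ?_
    intro φ h1 h2 h3
    have e := (hG φ ⟨h1, h2, h3⟩).symm.trans (hH φ ⟨h1, h2, h3⟩)
    have iG : Integrable (fun x => φ x • G x) (volume.restrict Ω) :=
      (hli G).integrable_smul_left_of_hasCompactSupport h1.continuous h2
    have iH : Integrable (fun x => φ x • H x) (volume.restrict Ω) :=
      (hli H).integrable_smul_left_of_hasCompactSupport h1.continuous h2
    simp only [smul_sub]
    rw [integral_sub iG iH, sub_eq_zero]
    exact neg_injective e
  refine Lp.ext ?_
  filter_upwards [key, ae_restrict_mem hΩ.measurableSet] with x hx hm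
  exact sub_eq_zero.1 (hx hm)

theorem IsWeakGradient.weakGrad_eq {N : ℕ} {Ω : Set (EuclideanSpace ℝ (Fin N))} (hΩ : IsOpen Ω)
    {u : L2 Ω} {G : L2Vec Ω} (hG : IsWeakGradient Ω u G) : weakGrad Ω u = G := by
  have h : ∃ G : L2Vec Ω, IsWeakGradient Ω u G := ⟨G, hG⟩
  rw [weakGrad, dif_pos h]
  exact h.choose_spec.unique hΩ hG

/-- `W^{1,2}_0(Ω)`: the closure of `C^∞_0(Ω)` in `W^{1,2}(Ω)` with respect to the norm
`‖φ‖_{L²(Ω)} + ‖∇φ‖_{L²(Ω; ℝ^N)}`. -/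
def W012 {N : ℕ} (Ω : Set (EuclideanSpace ℝ (Fin N))) : Set (L2 Ω) :=
  {u | u ∈ W12 Ω ∧ ∃ φ : ℕ → EuclideanSpace ℝ (Fin N) → ℝ, (∀ n, IsTestFunction Ω (φ n)) ∧
    Tendsto (fun n =>
      eLpNorm (fun x => φ n x - u x) 2 (volume.restrict Ω) +
      eLpNorm (fun x => gradient (φ n) x - weakGrad Ω u x) 2 (volume.restrict Ω))
      atTop (𝓝 0)}

/-- The energy `½ ∫_Ω |∇u|² dx - (α/q) ∫_Ω |u|^q dx`. -/
noncomputable def energy {N : ℕ} (Ω : Set (EuclideanSpace ℝ (Fin N))) (q α : ℝ) (u : L2 Ω) : ℝ :=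
  (1 / 2) * (∫ x in Ω, ‖weakGrad Ω u x‖ ^ 2) - (α / q) * ∫ x in Ω, |u x| ^ q

/-- `u ∈ W^{1,2}_0(Ω)` is a weak solution of `-Δu = α |u|^{q-2} u` in `Ω`. -/
def IsWeakSolution {N : ℕ} (Ω : Set (EuclideanSpace ℝ (Fin N))) (q α : ℝ) (u : L2 Ω) : Prop :=
  u ∈ W012 Ω ∧ ∀ φ ∈ W012 Ω,
    ∫ x in Ω, inner ℝ (weakGrad Ω u x) (weakGrad Ω φ x) =
      α * ∫ x in Ω, |u x| ^ (q - 2) * u x * φ x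

/-- The set of critical values of the energy. -/
def critValues {N : ℕ} (Ω : Set (EuclideanSpace ℝ (Fin N))) (q α : ℝ) : Set ℝ :=
  {l | ∃ u : L2 Ω, IsWeakSolution Ω q α u ∧ energy Ω q α u = l}

/-- The ground state level: the minimum of the energy over `W^{1,2}_0(Ω)`. -/
noncomputable def Lambda1 {N : ℕ} (Ω : Set (EuclideanSpace ℝ (Fin N))) (q α : ℝ) : ℝ :=
  sInf (energy Ω q α '' W012 Ω)

/-- The first excited level: the infimum of the critical values above the ground state level. -/
noncomputable def Lambda2 {N : ℕ} (Ω : Set (EuclideanSpace ℝ (Fin N))) (q α : ℝ) : ℝ :=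
  sInf {l | l ∈ critValues Ω q α ∧ Lambda1 Ω q α < l}

/-- `u` changes sign: neither `u⁺ = max(u, 0)` nor `u⁻ = max(-u, 0)` vanishes a.e. in `Ω`. -/
def SignChanging {N : ℕ} {Ω : Set (EuclideanSpace ℝ (Fin N))} (u : L2 Ω) : Prop :=
  Lp.posPart u ≠ 0 ∧ Lp.negPart u ≠ 0

end LaneEmden

/-! Write F for the energy. No minimizer is needed, only a nonnegative test function v with F(v) <
Λ₂. One exists because Λ₁ < Λ₂, test functions are dense in energy (`exists_tendsto_smoothEnergy`),
and a smoothed absolute value makes them nonnegative (`exists_nonneg_smoothEnergy_lt`).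

The support of v is compact, so it misses part of Ω, where a bump ψ ≥ 0 fits (`exists_bump`). Since
q < 2, F(cψ) = a c² - b c^q vanishes at some c₀ > 0 and is small and positive just to the right of
it (`exists_Ioo_mul_sq_sub_mul_rpow`). Disjoint supports give F(v - cψ) = F(v) + F(cψ), which lies
strictly between Λ₁ and Λ₂. The negative part cψ has positive energy. The positive part v is nonzero
because F(v) < Λ₂ ≤ 0, as 0 is a critical value above Λ₁. Distinct c give distinct functions, hence
infinitely many. -/

namespace LaneEmden

variable {N : ℕ} {Ω : Set (EuclideanSpace ℝ (Fin N))}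

/-! ### Classical gradients. -/

section Gradient

variable {F : Type*} [NormedAddCommGroup F] [InnerProductSpace ℝ F] [CompleteSpace F]

theorem norm_gradient (f : F → ℝ) (x : F) : ‖gradient f x‖ = ‖fderiv ℝ f x‖ := by
  rw [← toDual_gradient, LinearIsometryEquiv.norm_map]

theorem continuous_gradient {f : F → ℝ} (hf : ContDiff ℝ ∞ f) : Continuous (gradient f) :=
  (InnerProductSpace.toDual ℝ F).symm.continuous.comp (hf.continuous_fderiv (by simp))

theorem gradient_eq_zero_of_notMem_tsupport {f : F → ℝ} {x : F} (hx : x ∉ tsupport f) :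
    gradient f x = 0 := by
  have : fderiv ℝ f x = 0 :=
    image_eq_zero_of_notMem_tsupport fun h => hx (tsupport_fderiv_subset ℝ h)
  simp [gradient, this]

theorem hasCompactSupport_gradient {f : F → ℝ} (hf : HasCompactSupport f) :
    HasCompactSupport (gradient f) :=
  HasCompactSupport.intro hf fun _ hx => gradient_eq_zero_of_notMem_tsupport hx

theorem gradient_const_mul {f : F → ℝ} {x : F} (hf : DifferentiableAt ℝ f x) (c : ℝ) :
    gradient (fun y => c * f y) x = c • gradient f x := by
  simp only [gradient]
  rw [fderiv_const_mul hf]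
  simp

end Gradient

/-! ### Test functions as elements of W^{1,2}_0. -/

namespace IsTestFunction

variable {f g : EuclideanSpace ℝ (Fin N) → ℝ}

theorem differentiable (hf : IsTestFunction Ω f) : Differentiable ℝ f :=
  hf.1.differentiable (by simp)

theorem memLp (hf : IsTestFunction Ω f) (p : ENNReal) : MemLp f p (volume.restrict Ω) :=
  (hf.1.continuous.memLp_of_hasCompactSupport hf.2.1).restrict Ω

theorem memLp_gradient (hf : IsTestFunction Ω f) (p : ENNReal) :
    MemLp (gradient f) p (volume.restrict Ω) :=
  ((continuous_gradient hf.1).memLp_of_hasCompactSupport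
    (hasCompactSupport_gradient hf.2.1)).restrict Ω

theorem zero : IsTestFunction Ω 0 :=
  ⟨contDiff_const, HasCompactSupport.zero, by simp [tsupport]⟩

theorem const_mul (hf : IsTestFunction Ω f) (c : ℝ) : IsTestFunction Ω (fun x => c * f x) :=
  ⟨contDiff_const.mul hf.1, hf.2.1.mul_left, (tsupport_mul_subset_right).trans hf.2.2⟩

theorem sub (hf : IsTestFunction Ω f) (hg : IsTestFunction Ω g) :
    IsTestFunction Ω (fun x => f x - g x) :=
  ⟨hf.1.sub hg.1, hf.2.1.sub hg.2.1,
    (tsupport_sub f g).trans (Set.union_subset hf.2.2 hg.2.2)⟩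

theorem eq_zero_of_notMem (hf : IsTestFunction Ω f) {x : EuclideanSpace ℝ (Fin N)} (hx : x ∉ Ω) :
    f x = 0 :=
  image_eq_zero_of_notMem_tsupport fun h => hx (hf.2.2 h)

theorem gradient_eq_zero_of_notMem (hf : IsTestFunction Ω f) {x : EuclideanSpace ℝ (Fin N)}
    (hx : x ∉ Ω) : gradient f x = 0 :=
  gradient_eq_zero_of_notMem_tsupport fun h => hx (hf.2.2 h)

/-- The class in `L²(Ω)` of a test function. -/
noncomputable def toL2 (hf : IsTestFunction Ω f) : L2 Ω := (hf.memLp 2).toLp f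

theorem coeFn_toL2 (hf : IsTestFunction Ω f) : hf.toL2 =ᵐ[volume.restrict Ω] f :=
  (hf.memLp 2).coeFn_toLp

theorem integral_smul_gradient (hf : IsTestFunction Ω f) (hg : IsTestFunction Ω g) :
    ∫ x in Ω, f x • gradient g x = - ∫ x in Ω, g x • gradient f x := by
  have key : ∀ {f g : EuclideanSpace ℝ (Fin N) → ℝ}, IsTestFunction Ω f → IsTestFunction Ω g →
      ∫ x in Ω, f x • gradient g x = ∫ x, f x • gradient g x := fun hf _ =>
    setIntegral_eq_integral_of_forall_compl_eq_zero fun x hx => by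
      simp [hf.eq_zero_of_notMem hx]
  have int : ∀ {f g : EuclideanSpace ℝ (Fin N) → ℝ}, IsTestFunction Ω f → IsTestFunction Ω g →
      Integrable (fun x => f x • gradient g x) := fun hf hg =>
    (hf.1.continuous.smul (continuous_gradient hg.1)).integrable_of_hasCompactSupport
      hf.2.1.smul_right
  rw [key hf hg, key hg hf]
  -- Pairing with a fixed vector reduces the identity to scalar integration by parts.
  refine ext_inner_left ℝ fun v => ?_
  have e : ∀ f g : EuclideanSpace ℝ (Fin N) → ℝ, ∀ x,
      inner ℝ v (f x • gradient g x) = f x * fderiv ℝ g x v := fun f g x => by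
    rw [inner_smul_right, inner_gradient_right]; simp
  rw [inner_neg_right, ← integral_inner (int hf hg), ← integral_inner (int hg hf)]
  simp only [e]
  have i1 := (int hf hg).const_inner (𝕜 := ℝ) v
  have i2 := (int hg hf).const_inner (𝕜 := ℝ) v
  simp only [e] at i1 i2
  rw [integral_mul_fderiv_eq_neg_fderiv_mul_of_integrable (by simpa only [mul_comm] using i2) i1
    ((hf.1.continuous.mul hg.1.continuous).integrable_of_hasCompactSupport hf.2.1.mul_right)
    (fun x _ => hf.differentiable x) (fun x _ => hg.differentiable x)]
  simp only [mul_comm]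

theorem isWeakGradient_toL2 (hf : IsTestFunction Ω f) :
    IsWeakGradient Ω hf.toL2 ((hf.memLp_gradient 2).toLp (gradient f)) := by
  intro φ hφ
  have h1 : ∫ x in Ω, hf.toL2 x • gradient φ x = ∫ x in Ω, f x • gradient φ x :=
    integral_congr_ae (by filter_upwards [hf.coeFn_toL2] with x hx; rw [hx])
  have h2 : ∫ x in Ω, φ x • ((hf.memLp_gradient 2).toLp (gradient f)) x =
      ∫ x in Ω, φ x • gradient f x :=
    integral_congr_ae (by
      filter_upwards [(hf.memLp_gradient 2).coeFn_toLp] with x hx; rw [hx])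
  rw [h1, h2, hf.integral_smul_gradient hφ]

theorem weakGrad_toL2 (hf : IsTestFunction Ω f) (hΩ : IsOpen Ω) :
    weakGrad Ω hf.toL2 =ᵐ[volume.restrict Ω] gradient f := by
  rw [hf.isWeakGradient_toL2.weakGrad_eq hΩ]
  exact (hf.memLp_gradient 2).coeFn_toLp

theorem toL2_mem_W012 (hf : IsTestFunction Ω f) (hΩ : IsOpen Ω) : hf.toL2 ∈ W012 Ω := by
  refine ⟨⟨_, hf.isWeakGradient_toL2⟩, fun _ => f, fun _ => hf, ?_⟩
  have h1 : eLpNorm (fun x => f x - hf.toL2 x) 2 (volume.restrict Ω) = 0 := by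
    rw [← eLpNorm_zero (p := 2) (μ := volume.restrict Ω) (ε := ℝ)]
    refine eLpNorm_congr_ae ?_
    filter_upwards [hf.coeFn_toL2] with x hx
    simp [hx]
  have h2 : eLpNorm (fun x => gradient f x - weakGrad Ω hf.toL2 x) 2 (volume.restrict Ω) = 0 := by
    rw [← eLpNorm_zero (p := 2) (μ := volume.restrict Ω) (ε := EuclideanSpace ℝ (Fin N))]
    refine eLpNorm_congr_ae ?_
    filter_upwards [hf.weakGrad_toL2 hΩ] with x hx
    simp [hx]
  simp [h1, h2]

end IsTestFunction

/-! ### Density of test functions in energy. -/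

/-- The energy of a smooth function, written with its classical gradient. -/
noncomputable def smoothEnergy (Ω : Set (EuclideanSpace ℝ (Fin N))) (q α : ℝ)
    (f : EuclideanSpace ℝ (Fin N) → ℝ) : ℝ :=
  (1 / 2) * (∫ x in Ω, ‖gradient f x‖ ^ 2) - (α / q) * ∫ x in Ω, |f x| ^ q

theorem IsTestFunction.energy_toL2 {f : EuclideanSpace ℝ (Fin N) → ℝ} (hf : IsTestFunction Ω f)
    (hΩ : IsOpen Ω) (q α : ℝ) : energy Ω q α hf.toL2 = smoothEnergy Ω q α f := by
  have h1 : ∫ x in Ω, ‖weakGrad Ω hf.toL2 x‖ ^ 2 = ∫ x in Ω, ‖gradient f x‖ ^ 2 :=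
    integral_congr_ae (by filter_upwards [hf.weakGrad_toL2 hΩ] with x hx; rw [hx])
  have h2 : ∫ x in Ω, |hf.toL2 x| ^ q = ∫ x in Ω, |f x| ^ q :=
    integral_congr_ae (by filter_upwards [hf.coeFn_toL2] with x hx; rw [hx])
  rw [energy, smoothEnergy, h1, h2]

/-- Norms converge along L^p limits. Keeping the exponent real covers both energy terms, with p = 2
and p = q. -/
theorem tendsto_integral_norm_rpow {X E : Type*} [MeasurableSpace X] {μ : Measure X}
    [NormedAddCommGroup E] {p : ℝ} (hp : 1 ≤ p) {f : ℕ → X → E} {g : X → E}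
    (hf : ∀ n, MemLp (f n) (ENNReal.ofReal p) μ) (hg : MemLp g (ENNReal.ofReal p) μ)
    (h : Tendsto (fun n => eLpNorm (f n - g) (ENNReal.ofReal p) μ) atTop (𝓝 0)) :
    Tendsto (fun n => ∫ x, ‖f n x‖ ^ p ∂μ) atTop (𝓝 (∫ x, ‖g x‖ ^ p ∂μ)) := by
  have hp0 : 0 < p := by linarith
  have : Fact (1 ≤ ENNReal.ofReal p) := ⟨by simpa using ENNReal.ofReal_le_ofReal hp⟩
  have h1 := ((Lp.tendsto_Lp_iff_tendsto_eLpNorm'' f hf g hg).2 h).norm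
  have h2 : ∀ {k : X → E} (hk : MemLp k (ENNReal.ofReal p) μ),
      ‖hk.toLp k‖ ^ p = ∫ x, ‖k x‖ ^ p ∂μ := fun {k} hk => by
    have i0 : 0 ≤ ∫ x, ‖k x‖ ^ p ∂μ := integral_nonneg fun x => by positivity
    rw [Lp.norm_toLp, hk.eLpNorm_eq_integral_rpow_norm (by simpa using hp0) (by simp),
      ENNReal.toReal_ofReal hp0.le, ENNReal.toReal_ofReal (by positivity),
      Real.rpow_inv_rpow i0 hp0.ne']
  simpa only [h2] using h1.rpow_const (p := p) (Or.inr hp0.le)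

theorem isFiniteMeasure_restrict (hΩb : Bornology.IsBounded Ω) :
    IsFiniteMeasure ((volume : Measure (EuclideanSpace ℝ (Fin N))).restrict Ω) :=
  ⟨by simpa using hΩb.measure_lt_top⟩

/-- Test functions are dense in energy in `W^{1,2}_0(Ω)`. -/
theorem exists_tendsto_smoothEnergy (hΩb : Bornology.IsBounded Ω) {q : ℝ} (hq1 : 1 < q)
    (hq2 : q < 2) (α : ℝ) {u : L2 Ω} (hu : u ∈ W012 Ω) :
    ∃ φ : ℕ → EuclideanSpace ℝ (Fin N) → ℝ, (∀ n, IsTestFunction Ω (φ n)) ∧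
      Tendsto (fun n => smoothEnergy Ω q α (φ n)) atTop (𝓝 (energy Ω q α u)) := by
  have := isFiniteMeasure_restrict hΩb
  obtain ⟨-, φ, hφ, hlim⟩ := hu
  have l1 : Tendsto (fun n => eLpNorm (φ n - ⇑u) 2 (volume.restrict Ω)) atTop (𝓝 0) :=
    tendsto_of_tendsto_of_tendsto_of_le_of_le tendsto_const_nhds hlim (fun _ => zero_le)
      (fun n => le_self_add)
  have l2 : Tendsto (fun n => eLpNorm (gradient (φ n) - ⇑(weakGrad Ω u)) 2 (volume.restrict Ω))
      atTop (𝓝 0) :=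
    tendsto_of_tendsto_of_tendsto_of_le_of_le tendsto_const_nhds hlim (fun _ => zero_le)
      (fun n => le_add_self)
  have e2 : ENNReal.ofReal 2 = 2 := by simp
  have hq : ENNReal.ofReal q ≤ 2 := by
    rw [← e2]; exact ENNReal.ofReal_le_ofReal hq2.le
  have l3 : Tendsto (fun n => eLpNorm (φ n - ⇑u) (ENNReal.ofReal q) (volume.restrict Ω))
      atTop (𝓝 0) := by
    -- Hölder on a set of finite measure: L² convergence implies L^q convergence.
    have l4 := ENNReal.Tendsto.mul_const (b := (volume.restrict Ω) Set.univ ^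
      (1 / (ENNReal.ofReal q).toReal - 1 / (2 : ENNReal).toReal)) l1 (Or.inr (by
        refine ENNReal.rpow_ne_top_of_nonneg ?_ (measure_ne_top _ _)
        rw [ENNReal.toReal_ofReal (by linarith), ENNReal.toReal_ofNat, sub_nonneg]
        exact one_div_le_one_div_of_le (by linarith) hq2.le))
    rw [zero_mul] at l4
    exact tendsto_of_tendsto_of_tendsto_of_le_of_le tendsto_const_nhds l4 (fun _ => zero_le)
      (fun n => eLpNorm_le_eLpNorm_mul_rpow_measure_univ hq
        (((hφ n).memLp 2).1.sub (Lp.memLp u).1))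
  refine ⟨φ, hφ, Tendsto.sub (Tendsto.const_mul _ ?_) (Tendsto.const_mul _ ?_)⟩
  · have := tendsto_integral_norm_rpow (p := 2) (by norm_num)
      (fun n => (hφ n).memLp_gradient _) (by rw [e2]; exact Lp.memLp (weakGrad Ω u))
      (by rw [e2]; exact l2)
    simpa only [Real.rpow_two] using this
  · exact tendsto_integral_norm_rpow hq1.le (fun n => (hφ n).memLp _)
      ((Lp.memLp u).mono_exponent hq) l3

/-! ### Poincaré inequality and lower bound for the energy. -/

/-- The **Poincaré inequality** on a bounded set. -/
theorem exists_poincare (hN : 1 ≤ N) (hΩb : Bornology.IsBounded Ω) :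
    ∃ C : ℝ, 0 < C ∧ ∀ f : EuclideanSpace ℝ (Fin N) → ℝ, IsTestFunction Ω f →
      ∫ x in Ω, f x ^ 2 ≤ C * ∫ x in Ω, ‖gradient f x‖ ^ 2 := by
  obtain ⟨R, hR0, hR⟩ := hΩb.exists_pos_norm_le
  -- Integrate f² by parts against a coordinate l, with |l| ≤ R on Ω; Young's inequality leaves ½∫f²
  -- + 2R²∫|∇f|², and absorbing the first term gives 4R².
  refine ⟨4 * R ^ 2, by positivity, fun f hf => ?_⟩
  let i : Fin N := ⟨0, hN⟩
  let e : EuclideanSpace ℝ (Fin N) := EuclideanSpace.single i 1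
  have he : ‖e‖ = 1 := by simp [e]
  let l : EuclideanSpace ℝ (Fin N) →L[ℝ] ℝ := innerSL ℝ e
  have hl : ∀ x, fderiv ℝ l x e = 1 := fun x => by
    rw [l.fderiv]; simp [l, he]
  have hd : ∀ x, fderiv ℝ (fun y => f y ^ 2) x e = 2 * f x * inner ℝ (gradient f x) e :=
    fun x => by
      rw [fderiv_fun_pow 2 (hf.differentiable x), inner_gradient_left]; simp
  have cg := continuous_gradient hf.1
  have cf := hf.1.continuous
  have sq : HasCompactSupport fun y => f y ^ 2 :=
    HasCompactSupport.intro hf.2.1 fun x hx => by simp [image_eq_zero_of_notMem_tsupport hx]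
  have i1 : Integrable fun x => 2 * f x * inner ℝ (gradient f x) e * l x :=
    Continuous.integrable_of_hasCompactSupport (by fun_prop)
      (HasCompactSupport.intro hf.2.1 fun x hx => by simp [image_eq_zero_of_notMem_tsupport hx])
  have i2 : Integrable fun x => f x ^ 2 :=
    Continuous.integrable_of_hasCompactSupport (by fun_prop) sq
  have i3 : Integrable fun x => ‖gradient f x‖ ^ 2 :=
    Continuous.integrable_of_hasCompactSupport (by fun_prop)
      (HasCompactSupport.intro hf.2.1 fun x hx => by
        simp [gradient_eq_zero_of_notMem_tsupport hx])
  have parts := integral_mul_fderiv_eq_neg_fderiv_mul_of_integrable (μ := volume)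
    (f := fun y => f y ^ 2) (g := l) (v := e) (by simpa only [hd] using i1)
    (by simpa only [hl, mul_one] using i2)
    (Continuous.integrable_of_hasCompactSupport (by fun_prop) sq.mul_right)
    (fun x _ => (hf.differentiable x).pow 2) (fun x _ => l.differentiableAt)
  simp only [hl, hd, mul_one] at parts
  rw [setIntegral_eq_integral_of_forall_compl_eq_zero
      fun x hx => by simp [hf.eq_zero_of_notMem hx],
    setIntegral_eq_integral_of_forall_compl_eq_zero
      fun x hx => by simp [hf.gradient_eq_zero_of_notMem hx]]
  have le : ∫ x, f x ^ 2 ≤ ∫ x, ((1 / 2) * f x ^ 2 + 2 * R ^ 2 * ‖gradient f x‖ ^ 2) := by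
    rw [parts, ← integral_neg]
    refine integral_mono i1.neg ((i2.const_mul _).add (i3.const_mul _)) fun x => ?_
    by_cases hx : x ∈ Ω
    · have b1 : |inner ℝ (gradient f x) e| ≤ ‖gradient f x‖ := by
        simpa [he] using abs_real_inner_le_norm (gradient f x) e
      have b2 : |l x| ≤ R := by
        have := abs_real_inner_le_norm e x
        rw [he, one_mul] at this
        exact this.trans (hR x hx)
      have b3 : |inner ℝ (gradient f x) e * l x| ≤ ‖gradient f x‖ * R := by
        rw [abs_mul]; gcongr
      have b4 : -(2 * f x * inner ℝ (gradient f x) e * l x) ≤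
          2 * (|f x| * (‖gradient f x‖ * R)) := by
        have : |f x * (inner ℝ (gradient f x) e * l x)| ≤ |f x| * (‖gradient f x‖ * R) := by
          rw [abs_mul]; gcongr
        have := neg_le_of_abs_le this
        linarith
      have b5 := sq_nonneg (|f x| - 2 * (‖gradient f x‖ * R))
      have b6 := sq_abs (f x)
      simp only
      nlinarith
    · simp [hf.eq_zero_of_notMem hx, hf.gradient_eq_zero_of_notMem hx]
  rw [integral_add (i2.const_mul _) (i3.const_mul _), integral_const_mul,
    integral_const_mul] at le
  linarith

theorem exists_rpow_le_mul_sq_add {q δ : ℝ} (hq1 : 1 < q) (hq2 : q < 2) (hδ : 0 < δ) :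
    ∃ K : ℝ, ∀ t : ℝ, |t| ^ q ≤ δ * t ^ 2 + K := by
  -- The threshold solves t^(q-2) = δ; beyond it the quadratic term dominates, and below it the
  -- constant does.
  refine ⟨(δ ^ (1 / (q - 2))) ^ q, fun t => ?_⟩
  have hK : 0 < δ ^ (1 / (q - 2)) := by positivity
  rcases le_or_gt |t| (δ ^ (1 / (q - 2))) with h | h
  · have : |t| ^ q ≤ (δ ^ (1 / (q - 2))) ^ q := by gcongr
    have := mul_nonneg hδ.le (sq_nonneg t)
    linarith
  · have ht : 0 < |t| := hK.trans h
    have h1 : |t| ^ (q - 2) ≤ δ := by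
      have := Real.rpow_le_rpow_of_nonpos hK h.le (by linarith : q - 2 ≤ 0)
      rwa [← Real.rpow_mul hδ.le, one_div_mul_cancel (by linarith), Real.rpow_one] at this
    have h2 : |t| ^ q = |t| ^ (q - 2) * t ^ 2 := by
      rw [← sq_abs t, ← Real.rpow_two, ← Real.rpow_add ht]; congr 1; ring
    rw [h2]
    have : |t| ^ (q - 2) * t ^ 2 ≤ δ * t ^ 2 := by gcongr
    have : 0 ≤ (δ ^ (1 / (q - 2))) ^ q := by positivity
    linarith

theorem exists_le_smoothEnergy (hN : 1 ≤ N) (hΩb : Bornology.IsBounded Ω) {q α : ℝ}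
    (hq1 : 1 < q) (hq2 : q < 2) (hα : 0 < α) :
    ∃ m : ℝ, ∀ f : EuclideanSpace ℝ (Fin N) → ℝ, IsTestFunction Ω f →
      m ≤ smoothEnergy Ω q α f := by
  have := isFiniteMeasure_restrict hΩb
  obtain ⟨C, hC, hP⟩ := exists_poincare hN hΩb
  have hq0 : 0 < q := by linarith
  -- This δ makes the Poincaré bound of the potential term consume exactly ½∫|∇f|².
  obtain ⟨K, hK⟩ := exists_rpow_le_mul_sq_add hq1 hq2
    (show 0 < q / (2 * α * C) by positivity)
  refine ⟨-(α / q * ∫ x in Ω, K), fun f hf => ?_⟩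
  have i2 : Integrable (fun x => f x ^ 2) (volume.restrict Ω) := (hf.memLp 2).integrable_sq
  have h1 : ∫ x in Ω, |f x| ^ q ≤ ∫ x in Ω, (q / (2 * α * C) * f x ^ 2 + K) :=
    integral_mono_of_nonneg (Eventually.of_forall fun x => by positivity)
      ((i2.const_mul _).add (integrable_const K)) (Eventually.of_forall fun x => hK _)
  rw [integral_add (i2.const_mul _) (integrable_const K), integral_const_mul] at h1
  have h2 := hP f hf
  have h3 : α / q * ∫ x in Ω, |f x| ^ q ≤
      α / q * (q / (2 * α * C) * (C * ∫ x in Ω, ‖gradient f x‖ ^ 2) + ∫ x in Ω, K) := by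
    gcongr
    refine h1.trans ?_
    gcongr
  have h4 : α / q * (q / (2 * α * C) * (C * ∫ x in Ω, ‖gradient f x‖ ^ 2) + ∫ x in Ω, K) =
      1 / 2 * (∫ x in Ω, ‖gradient f x‖ ^ 2) + α / q * ∫ x in Ω, K := by
    field_simp
  rw [h4] at h3
  rw [smoothEnergy]
  linarith

theorem bddBelow_energy (hN : 1 ≤ N) (hΩb : Bornology.IsBounded Ω) {q α : ℝ}
    (hq1 : 1 < q) (hq2 : q < 2) (hα : 0 < α) : BddBelow (energy Ω q α '' W012 Ω) := by
  obtain ⟨m, hm⟩ := exists_le_smoothEnergy hN hΩb hq1 hq2 hα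
  refine ⟨m, ?_⟩
  rintro _ ⟨u, hu, rfl⟩
  obtain ⟨φ, hφ, hlim⟩ := exists_tendsto_smoothEnergy hΩb hq1 hq2 α hu
  exact ge_of_tendsto' hlim fun n => hm _ (hφ n)

/-! ### Smoothed absolute value. -/

section SmoothAbs

/-- A smooth approximation from below of the absolute value. -/
noncomputable def smoothAbs (ε t : ℝ) : ℝ := √(t ^ 2 + ε ^ 2) - ε

variable {ε : ℝ}

theorem smoothAbs_zero (hε : 0 < ε) : smoothAbs ε 0 = 0 := by
  simp [smoothAbs, Real.sqrt_sq hε.le]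

theorem smoothAbs_nonneg (t : ℝ) : 0 ≤ smoothAbs ε t :=
  sub_nonneg.2 (Real.le_sqrt_of_sq_le (by nlinarith [sq_nonneg t]))

theorem smoothAbs_le_abs (hε : 0 < ε) (t : ℝ) : smoothAbs ε t ≤ |t| := by
  rw [smoothAbs, sub_le_iff_le_add]
  refine Real.sqrt_le_iff.2 ⟨by positivity, ?_⟩
  nlinarith [sq_abs t, mul_nonneg (abs_nonneg t) hε.le]

theorem tendsto_smoothAbs (t : ℝ) : Tendsto (fun ε => smoothAbs ε t) (𝓝[>] 0) (𝓝 |t|) := by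
  have : Continuous fun ε => smoothAbs ε t := by unfold smoothAbs; fun_prop
  have h := this.tendsto 0
  simp only [smoothAbs, ne_eq, OfNat.ofNat_ne_zero, not_false_eq_true, zero_pow, add_zero,
    sub_zero, Real.sqrt_sq_eq_abs] at h
  exact h.mono_left nhdsWithin_le_nhds

theorem contDiff_smoothAbs (hε : 0 < ε) : ContDiff ℝ ∞ (smoothAbs ε) := by
  unfold smoothAbs
  exact (((contDiff_id.pow 2).add contDiff_const).sqrt fun t => by
    have := sq_nonneg t
    have := pow_pos hε 2
    simp only [id]
    linarith).sub contDiff_const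

theorem abs_deriv_smoothAbs_le (hε : 0 < ε) (t : ℝ) : |deriv (smoothAbs ε) t| ≤ 1 := by
  have h0 : 0 < t ^ 2 + ε ^ 2 := by positivity
  have h : HasDerivAt (smoothAbs ε) (2 * t / (2 * √(t ^ 2 + ε ^ 2))) t := by
    have h1 : HasDerivAt (fun s : ℝ => s ^ 2 + ε ^ 2) (2 * t) t := by
      simpa using (hasDerivAt_pow 2 t).add_const (ε ^ 2)
    exact (h1.sqrt h0.ne').sub_const ε
  rw [h.deriv, mul_div_mul_left _ _ two_ne_zero, abs_div, abs_of_nonneg (Real.sqrt_nonneg _)]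
  refine div_le_one_of_le₀ (Real.abs_le_sqrt ?_) (Real.sqrt_nonneg _)
  nlinarith

/-- Subtracting ε makes `smoothAbs ε` vanish at 0, so composition does not enlarge the support. -/
theorem IsTestFunction.smoothAbs_comp {f : EuclideanSpace ℝ (Fin N) → ℝ}
    (hf : IsTestFunction Ω f) (hε : 0 < ε) : IsTestFunction Ω (smoothAbs ε ∘ f) :=
  ⟨(contDiff_smoothAbs hε).comp hf.1, hf.2.1.comp_left (smoothAbs_zero hε),
    (closure_mono (Function.support_comp_subset (smoothAbs_zero hε) f)).trans hf.2.2⟩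

theorem norm_gradient_smoothAbs_comp_le {f : EuclideanSpace ℝ (Fin N) → ℝ}
    (hf : IsTestFunction Ω f) (hε : 0 < ε) (x : EuclideanSpace ℝ (Fin N)) :
    ‖gradient (smoothAbs ε ∘ f) x‖ ≤ ‖gradient f x‖ := by
  have h := ((contDiff_smoothAbs hε).differentiable (by simp) (f x)).hasDerivAt.comp_hasFDerivAt x
    (hf.differentiable x).hasFDerivAt
  rw [norm_gradient, norm_gradient, h.fderiv, norm_smul, Real.norm_eq_abs]
  exact mul_le_of_le_one_left (norm_nonneg _) (abs_deriv_smoothAbs_le hε _)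

end SmoothAbs

theorem IsTestFunction.integrable_rpow
    {f : EuclideanSpace ℝ (Fin N) → ℝ} (hf : IsTestFunction Ω f) {q : ℝ} (hq : 0 < q) :
    Integrable (fun x => |f x| ^ q) (volume.restrict Ω) := by
  have := (hf.memLp (ENNReal.ofReal q)).integrable_norm_rpow (by simpa using hq) (by simp)
  simpa only [ENNReal.toReal_ofReal hq.le, Real.norm_eq_abs] using this

theorem IsTestFunction.integrable_norm_gradient_sq
    {f : EuclideanSpace ℝ (Fin N) → ℝ} (hf : IsTestFunction Ω f) :
    Integrable (fun x => ‖gradient f x‖ ^ 2) (volume.restrict Ω) :=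
  (hf.memLp_gradient 2).norm.integrable_sq

/-- A strict upper bound on the energy of a test function is inherited by a nonnegative one. -/
theorem exists_nonneg_smoothEnergy_lt {q α E : ℝ} (hq : 0 < q)
    {f : EuclideanSpace ℝ (Fin N) → ℝ} (hf : IsTestFunction Ω f)
    (hE : smoothEnergy Ω q α f < E) :
    ∃ v, IsTestFunction Ω v ∧ (∀ x, 0 ≤ v x) ∧ smoothEnergy Ω q α v < E := by
  -- Smoothing never increases the gradient term, but may shrink ∫|f|^q; this loss vanishes as ε →
  -- 0, so the strict inequality survives for small ε.
  have lim : Tendsto (fun ε => ∫ x in Ω, |smoothAbs ε (f x)| ^ q) (𝓝[>] 0)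
      (𝓝 (∫ x in Ω, |f x| ^ q)) := by
    refine tendsto_integral_filter_of_dominated_convergence (fun x => |f x| ^ q) ?_ ?_
      (hf.integrable_rpow hq) ?_
    · filter_upwards [self_mem_nhdsWithin] with ε hε
      exact ((hf.smoothAbs_comp hε).integrable_rpow hq).1
    · filter_upwards [self_mem_nhdsWithin] with ε hε
      refine Eventually.of_forall fun x => ?_
      rw [Real.norm_eq_abs, abs_of_nonneg (by positivity), abs_of_nonneg (smoothAbs_nonneg _)]
      exact Real.rpow_le_rpow (smoothAbs_nonneg _) (smoothAbs_le_abs hε _) hq.le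
    · refine Eventually.of_forall fun x => ?_
      simpa only [abs_abs] using (tendsto_smoothAbs (f x)).abs.rpow_const (Or.inr hq.le)
  have lim' := (lim.const_mul (α / q)).const_sub (1 / 2 * ∫ x in Ω, ‖gradient f x‖ ^ 2)
  obtain ⟨ε, hε, hεpos⟩ := ((lim'.eventually (gt_mem_nhds hE)).and self_mem_nhdsWithin).exists
  have hv := hf.smoothAbs_comp hεpos
  refine ⟨_, hv, fun x => smoothAbs_nonneg _, lt_of_le_of_lt ?_ hε⟩
  have : ∫ x in Ω, ‖gradient (smoothAbs ε ∘ f) x‖ ^ 2 ≤ ∫ x in Ω, ‖gradient f x‖ ^ 2 :=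
    integral_mono hv.integrable_norm_gradient_sq hf.integrable_norm_gradient_sq fun x => by
      have := norm_gradient_smoothAbs_comp_le hf hεpos x
      simp only
      gcongr
  simp only [smoothEnergy, Function.comp_apply]
  linarith

/-! ### Scaling, disjoint supports and bumps. -/

theorem smoothEnergy_const_mul {q α c : ℝ} (hc : 0 ≤ c) {f : EuclideanSpace ℝ (Fin N) → ℝ}
    (hf : IsTestFunction Ω f) :
    smoothEnergy Ω q α (fun x => c * f x) =
      (1 / 2 * ∫ x in Ω, ‖gradient f x‖ ^ 2) * c ^ 2 - (α / q * ∫ x in Ω, |f x| ^ q) * c ^ q := by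
  have h1 : ∀ x, ‖gradient (fun y => c * f y) x‖ ^ 2 = c ^ 2 * ‖gradient f x‖ ^ 2 := fun x => by
    rw [gradient_const_mul (hf.differentiable x), norm_smul, mul_pow, Real.norm_eq_abs, sq_abs]
  have h2 : ∀ x, |c * f x| ^ q = c ^ q * |f x| ^ q := fun x => by
    rw [abs_mul, abs_of_nonneg hc, Real.mul_rpow hc (abs_nonneg _)]
  simp only [smoothEnergy, h1, h2, integral_const_mul]
  ring

/-- At every point one of the two functions vanishes together with its gradient. -/
theorem smoothEnergy_sub_of_disjoint {q : ℝ} (hq : 0 < q) (α : ℝ)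
    {f g : EuclideanSpace ℝ (Fin N) → ℝ} (hf : IsTestFunction Ω f) (hg : IsTestFunction Ω g)
    (hfg : Disjoint (tsupport f) (tsupport g)) :
    smoothEnergy Ω q α (fun x => f x - g x) = smoothEnergy Ω q α f + smoothEnergy Ω q α g := by
  have hgrad : ∀ x, gradient (fun y => f y - g y) x = gradient f x - gradient g x := fun x => by
    simp only [gradient]
    rw [fderiv_fun_sub (hf.differentiable x) (hg.differentiable x), map_sub]
  have hx : ∀ x, x ∉ tsupport f ∨ x ∉ tsupport g := fun x => by
    by_contra! h
    exact Set.disjoint_left.1 hfg h.1 h.2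
  have h1 : ∀ x, ‖gradient (fun y => f y - g y) x‖ ^ 2 =
      ‖gradient f x‖ ^ 2 + ‖gradient g x‖ ^ 2 := fun x => by
    rw [hgrad]
    rcases hx x with h | h <;> simp [gradient_eq_zero_of_notMem_tsupport h]
  have h2 : ∀ x, |f x - g x| ^ q = |f x| ^ q + |g x| ^ q := fun x => by
    rcases hx x with h | h <;> simp [image_eq_zero_of_notMem_tsupport h, Real.zero_rpow hq.ne']
  simp only [smoothEnergy, h1, h2]
  rw [integral_add hf.integrable_norm_gradient_sq hg.integrable_norm_gradient_sq,
    integral_add (hf.integrable_rpow hq) (hg.integrable_rpow hq)]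
  ring

/-- Otherwise Ω would be compact and open, hence clopen in the connected, noncompact space ℝ^N. -/
theorem exists_mem_notMem_of_isCompact (hN : 1 ≤ N) (hΩo : IsOpen Ω) (hΩne : Ω.Nonempty)
    {K : Set (EuclideanSpace ℝ (Fin N))} (hK : IsCompact K) (hKΩ : K ⊆ Ω) :
    ∃ x ∈ Ω, x ∉ K := by
  by_contra! h
  obtain rfl : Ω = K := Set.Subset.antisymm h hKΩ
  have : Nonempty (Fin N) := ⟨⟨0, hN⟩⟩
  rcases isClopen_iff.1 ⟨hK.isClosed, hΩo⟩ with h | h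
  · exact hΩne.ne_empty h
  · exact noncompact_univ _ (h ▸ hK)

/-- Away from a compact set there is still room for a nontrivial nonnegative test function. -/
theorem exists_bump (hN : 1 ≤ N) (hΩo : IsOpen Ω) (hΩne : Ω.Nonempty)
    {K : Set (EuclideanSpace ℝ (Fin N))} (hK : IsCompact K) (hKΩ : K ⊆ Ω) :
    ∃ ψ, IsTestFunction Ω ψ ∧ (∀ x, 0 ≤ ψ x) ∧ ψ ≠ 0 ∧ Disjoint K (tsupport ψ) := by
  obtain ⟨x, hxΩ, hxK⟩ := exists_mem_notMem_of_isCompact hN hΩo hΩne hK hKΩ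
  obtain ⟨ψ, h1, h2, h3, h4, h5⟩ := exists_contDiff_tsupport_subset (n := ⊤)
    ((hΩo.sdiff hK.isClosed).mem_nhds ⟨hxΩ, hxK⟩)
  refine ⟨ψ, ⟨h3, h2, fun y hy => (h1 hy).1⟩, fun y => (h4 ⟨y, rfl⟩).1, fun h => ?_,
    Set.disjoint_right.2 fun y hy => (h1 hy).2⟩
  simp [h] at h5

theorem IsTestFunction.integral_abs_rpow_pos {q : ℝ} (hq : 0 < q)
    {f : EuclideanSpace ℝ (Fin N) → ℝ} (hf : IsTestFunction Ω f) (h : f ≠ 0) :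
    0 < ∫ x in Ω, |f x| ^ q := by
  rw [setIntegral_eq_integral_of_forall_compl_eq_zero
      fun x hx => by simp [hf.eq_zero_of_notMem hx, hq.ne']]
  have hc : Continuous fun x => |f x| ^ q :=
    hf.1.continuous.abs.rpow_const fun x => Or.inr hq.le
  refine hc.integral_pos_of_hasCompactSupport_nonneg_nonzero
    (HasCompactSupport.intro hf.2.1 fun x hx => by
      simp [image_eq_zero_of_notMem_tsupport hx, hq.ne']) (fun x => by positivity)
    (x := (Function.ne_iff.1 h).choose) ?_
  have := (Function.ne_iff.1 h).choose_spec
  exact (Real.rpow_pos_of_pos (abs_pos.2 this) q).ne'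

theorem IsTestFunction.integral_sq_pos {f : EuclideanSpace ℝ (Fin N) → ℝ}
    (hf : IsTestFunction Ω f) (h : f ≠ 0) : 0 < ∫ x in Ω, f x ^ 2 := by
  have := hf.integral_abs_rpow_pos two_pos h
  simpa only [Real.rpow_two, sq_abs] using this

theorem IsTestFunction.integral_norm_gradient_sq_pos (hN : 1 ≤ N) (hΩb : Bornology.IsBounded Ω)
    {f : EuclideanSpace ℝ (Fin N) → ℝ} (hf : IsTestFunction Ω f) (h : f ≠ 0) :
    0 < ∫ x in Ω, ‖gradient f x‖ ^ 2 := by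
  obtain ⟨C, hC, hP⟩ := exists_poincare hN hΩb
  exact pos_of_mul_pos_right ((hf.integral_sq_pos h).trans_le (hP f hf)) hC.le

/-! ### The scalar function a c² - b c^q. -/

section Scalar

variable {a b q : ℝ}

/-- The sign is carried by the second factor, which is monotone in c when a > 0 and q < 2. -/
theorem mul_sq_sub_mul_rpow {c : ℝ} (hc : 0 < c) :
    a * c ^ 2 - b * c ^ q = c ^ q * (a * c ^ (2 - q) - b) := by
  have : c ^ 2 = c ^ q * c ^ (2 - q) := by
    rw [← Real.rpow_add hc, ← Real.rpow_two]; congr 1; ring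
  rw [this]; ring

theorem exists_mul_sq_sub_mul_rpow_neg (hq2 : q < 2) (hb : 0 < b) :
    ∃ c : ℝ, 0 < c ∧ a * c ^ 2 - b * c ^ q < 0 := by
  have h : Tendsto (fun c : ℝ => a * c ^ (2 - q) - b) (𝓝[>] 0) (𝓝 (a * 0 ^ (2 - q) - b)) :=
    (((Real.continuous_rpow_const (by linarith)).const_mul a).sub continuous_const).tendsto 0
      |>.mono_left nhdsWithin_le_nhds
  rw [Real.zero_rpow (by linarith), mul_zero, zero_sub] at h
  obtain ⟨c, h1, hc : 0 < c⟩ :=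
    ((h.eventually (gt_mem_nhds (neg_neg_of_pos hb))).and self_mem_nhdsWithin).exists
  refine ⟨c, hc, ?_⟩
  rw [mul_sq_sub_mul_rpow hc]
  exact mul_neg_of_pos_of_neg (by positivity) h1

/-- Take c₀ to be the positive zero: monotonicity gives positivity to its right, continuity the
bound by ε. -/
theorem exists_Ioo_mul_sq_sub_mul_rpow (hq0 : 0 ≤ q) (hq2 : q < 2) (ha : 0 < a) (hb : 0 < b)
    {ε : ℝ} (hε : 0 < ε) :
    ∃ c₀ c₁ : ℝ, 0 < c₀ ∧ c₀ < c₁ ∧ ∀ c ∈ Set.Ioo c₀ c₁,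
      0 < a * c ^ 2 - b * c ^ q ∧ a * c ^ 2 - b * c ^ q < ε := by
  have hq' : 0 < 2 - q := by linarith
  set c₀ : ℝ := (b / a) ^ (2 - q)⁻¹ with hc₀
  have h0 : 0 < c₀ := by positivity
  have hpow : c₀ ^ (2 - q) = b / a := Real.rpow_inv_rpow (by positivity) hq'.ne'
  have hz : a * c₀ ^ 2 - b * c₀ ^ q = 0 := by
    rw [mul_sq_sub_mul_rpow h0, hpow, mul_div_cancel₀ _ ha.ne', sub_self, mul_zero]
  have hcont : Continuous fun c : ℝ => a * c ^ 2 - b * c ^ q :=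
    ((continuous_pow 2).const_mul a).sub ((Real.continuous_rpow_const hq0).const_mul b)
  have hev : ∀ᶠ c in 𝓝[>] c₀, a * c ^ 2 - b * c ^ q < ε :=
    ((hcont.tendsto c₀).eventually (gt_mem_nhds (by simpa only [hz] using hε))).filter_mono
      nhdsWithin_le_nhds
  obtain ⟨c₁, h01, hsub⟩ := mem_nhdsGT_iff_exists_Ioo_subset.1 hev
  refine ⟨c₀, c₁, h0, h01, fun c hc => ⟨?_, hsub hc⟩⟩
  rw [mul_sq_sub_mul_rpow (h0.trans hc.1)]
  have hlt : b / a < c ^ (2 - q) := hpow ▸ Real.rpow_lt_rpow h0.le hc.1 hq'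
  have : 0 < c := h0.trans hc.1
  have := (div_lt_iff₀' ha).1 hlt
  exact mul_pos (by positivity) (by linarith)

end Scalar

/-! ### The zero solution and the levels Λ₁, Λ₂. -/

theorem toL2_zero : (IsTestFunction.zero : IsTestFunction Ω 0).toL2 = 0 :=
  MemLp.toLp_zero _

theorem zero_mem_W012 (hΩo : IsOpen Ω) : (0 : L2 Ω) ∈ W012 Ω :=
  toL2_zero ▸ IsTestFunction.zero.toL2_mem_W012 hΩo

theorem weakGrad_zero (hΩo : IsOpen Ω) : weakGrad Ω (0 : L2 Ω) =ᵐ[volume.restrict Ω] 0 := by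
  filter_upwards [toL2_zero (Ω := Ω) ▸ IsTestFunction.zero.weakGrad_toL2 hΩo] with x hx
  rw [hx]
  simp [gradient]

theorem energy_zero (hΩo : IsOpen Ω) {q : ℝ} (hq : q ≠ 0) (α : ℝ) :
    energy Ω q α (0 : L2 Ω) = 0 := by
  rw [← toL2_zero, IsTestFunction.energy_toL2 _ hΩo]
  simp [smoothEnergy, gradient, hq]

theorem isWeakSolution_zero (hΩo : IsOpen Ω) (q α : ℝ) : IsWeakSolution Ω q α (0 : L2 Ω) := by
  refine ⟨zero_mem_W012 hΩo, fun φ _ => ?_⟩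
  have h1 : ∫ x in Ω, inner ℝ (weakGrad Ω (0 : L2 Ω) x) (weakGrad Ω φ x) = 0 :=
    integral_eq_zero_of_ae (by filter_upwards [weakGrad_zero hΩo] with x hx; simp [hx])
  have h2 : ∫ x in Ω, |(0 : L2 Ω) x| ^ (q - 2) * (0 : L2 Ω) x * φ x = 0 :=
    integral_eq_zero_of_ae (by
      filter_upwards [Lp.coeFn_zero ℝ 2 (volume.restrict Ω)] with x hx
      rw [hx]
      simp)
  rw [h1, h2, mul_zero]

theorem Lambda1_le_energy (hN : 1 ≤ N) (hΩb : Bornology.IsBounded Ω) {q α : ℝ}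
    (hq1 : 1 < q) (hq2 : q < 2) (hα : 0 < α) {u : L2 Ω} (hu : u ∈ W012 Ω) :
    Lambda1 Ω q α ≤ energy Ω q α u :=
  csInf_le (bddBelow_energy hN hΩb hq1 hq2 hα) ⟨u, hu, rfl⟩

theorem Lambda1_neg (hN : 1 ≤ N) (hΩo : IsOpen Ω) (hΩb : Bornology.IsBounded Ω)
    (hΩne : Ω.Nonempty) {q α : ℝ} (hq1 : 1 < q) (hq2 : q < 2) (hα : 0 < α) :
    Lambda1 Ω q α < 0 := by
  obtain ⟨ψ, hψ, -, hne, -⟩ := exists_bump hN hΩo hΩne isCompact_empty (Set.empty_subset Ω)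
  have hB := hψ.integral_abs_rpow_pos (q := q) (by linarith) hne
  obtain ⟨c, hc, hneg⟩ := exists_mul_sq_sub_mul_rpow_neg
    (a := 1 / 2 * ∫ x in Ω, ‖gradient ψ x‖ ^ 2) hq2
    (show 0 < α / q * ∫ x in Ω, |ψ x| ^ q from mul_pos (div_pos hα (by linarith)) hB)
  rw [← smoothEnergy_const_mul hc.le hψ, ← (hψ.const_mul c).energy_toL2 hΩo] at hneg
  exact (Lambda1_le_energy hN hΩb hq1 hq2 hα ((hψ.const_mul c).toL2_mem_W012 hΩo)).trans_lt hneg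

/-- The zero solution puts 0 > Λ₁ among the competitors for Λ₂. -/
theorem Lambda2_nonpos (hN : 1 ≤ N) (hΩo : IsOpen Ω) (hΩb : Bornology.IsBounded Ω)
    (hΩne : Ω.Nonempty) {q α : ℝ} (hq1 : 1 < q) (hq2 : q < 2) (hα : 0 < α) :
    Lambda2 Ω q α ≤ 0 :=
  csInf_le ⟨Lambda1 Ω q α, fun _ hl => hl.2.le⟩
    ⟨⟨0, isWeakSolution_zero hΩo q α, energy_zero hΩo (by linarith) α⟩,
      Lambda1_neg hN hΩo hΩb hΩne hq1 hq2 hα⟩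

/-! ### Positive and negative parts; distinctness. -/

section Parts

variable {f g : EuclideanSpace ℝ (Fin N) → ℝ}

theorem IsTestFunction.posPart_toL2_sub (hf : IsTestFunction Ω f) (hg : IsTestFunction Ω g)
    (hf0 : ∀ x, 0 ≤ f x) (hg0 : ∀ x, 0 ≤ g x) (hfg : Disjoint (tsupport f) (tsupport g)) :
    Lp.posPart (hf.sub hg).toL2 = hf.toL2 := by
  refine Lp.ext ?_
  filter_upwards [Lp.coeFn_posPart (hf.sub hg).toL2, (hf.sub hg).coeFn_toL2, hf.coeFn_toL2]
    with x h1 h2 h3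
  rw [h1, h2, h3]
  by_cases hx : x ∈ tsupport f
  · simp [image_eq_zero_of_notMem_tsupport (Set.disjoint_left.1 hfg hx), hf0 x]
  · simp [image_eq_zero_of_notMem_tsupport hx, hg0 x]

theorem IsTestFunction.negPart_toL2_sub (hf : IsTestFunction Ω f) (hg : IsTestFunction Ω g)
    (hf0 : ∀ x, 0 ≤ f x) (hg0 : ∀ x, 0 ≤ g x) (hfg : Disjoint (tsupport f) (tsupport g)) :
    Lp.negPart (hf.sub hg).toL2 = hg.toL2 := by
  refine Lp.ext ?_
  filter_upwards [Lp.coeFn_negPart_eq_max (hf.sub hg).toL2, (hf.sub hg).coeFn_toL2,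
    hg.coeFn_toL2] with x h1 h2 h3
  rw [h1, h2, h3]
  by_cases hx : x ∈ tsupport f
  · simp [image_eq_zero_of_notMem_tsupport (Set.disjoint_left.1 hfg hx), hf0 x]
  · simp [image_eq_zero_of_notMem_tsupport hx, hg0 x]

theorem IsTestFunction.toL2_sub_const_mul_injective (hf : IsTestFunction Ω f)
    (hg : IsTestFunction Ω g) (hne : g ≠ 0) :
    Function.Injective fun c : ℝ => (hf.sub (hg.const_mul c)).toL2 := by
  intro c d hcd
  by_contra hne'
  refine (hg.integral_sq_pos hne).ne' (integral_eq_zero_of_ae ?_)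
  have hcd' : (hf.sub (hg.const_mul c)).toL2 = (hf.sub (hg.const_mul d)).toL2 := hcd
  filter_upwards [(hf.sub (hg.const_mul c)).coeFn_toL2, (hf.sub (hg.const_mul d)).coeFn_toL2]
    with x h1 h2
  rw [← hcd', h1] at h2
  have : (c - d) * g x = 0 := by linarith
  simp [(mul_eq_zero.1 this).resolve_left (sub_ne_zero.2 hne')]

end Parts

end LaneEmden

/-! ### The infinite family. -/

open LaneEmden in
theorem lemma3p5 {N : ℕ} (hN : 1 ≤ N) {q α : ℝ} (hq1 : 1 < q) (hq2 : q < 2) (hα : 0 < α)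
    (Ω : Set (EuclideanSpace ℝ (Fin N))) (hΩo : IsOpen Ω) (hΩb : Bornology.IsBounded Ω)
    (hΩne : Ω.Nonempty) (hΩc : Finite (ConnectedComponents Ω))
    (hgap : LaneEmden.Lambda1 Ω q α < LaneEmden.Lambda2 Ω q α) :
    Set.Infinite {φ : LaneEmden.L2 Ω | φ ∈ LaneEmden.W012 Ω ∧ LaneEmden.SignChanging φ ∧
      LaneEmden.Lambda1 Ω q α < LaneEmden.energy Ω q α φ ∧
      LaneEmden.energy Ω q α φ < LaneEmden.Lambda2 Ω q α ∧
      Lp.negPart φ ∈ LaneEmden.W012 Ω ∧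
      0 ≤ LaneEmden.energy Ω q α (Lp.negPart φ)} := by
  have hq0 : 0 < q := by linarith
  -- a nonnegative test function `v` with energy below `Λ₂`
  obtain ⟨_, ⟨u, hu, rfl⟩, hlt⟩ :=
    exists_lt_of_csInf_lt (Set.Nonempty.image _ ⟨0, zero_mem_W012 hΩo⟩) hgap
  obtain ⟨φ, hφ, hlim⟩ := exists_tendsto_smoothEnergy hΩb hq1 hq2 α hu
  obtain ⟨n, hn⟩ := (hlim.eventually (gt_mem_nhds hlt)).exists
  obtain ⟨v, hv, hv0, hvE⟩ := exists_nonneg_smoothEnergy_lt hq0 (hφ n) hn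
  -- the negative part is a multiple of a bump away from the support of `v`
  obtain ⟨ψ, hψ, hψ0, hψne, hdisj⟩ := exists_bump hN hΩo hΩne hv.2.1 hv.2.2
  have hA := hψ.integral_norm_gradient_sq_pos hN hΩb hψne
  have hB := hψ.integral_abs_rpow_pos hq0 hψne
  -- The tolerance is the room Λ₂ - F(v) left below Λ₂.
  obtain ⟨c₀, c₁, hc₀, hc₀₁, hc⟩ := exists_Ioo_mul_sq_sub_mul_rpow hq0.le hq2
    (show 0 < 1 / 2 * ∫ x in Ω, ‖gradient ψ x‖ ^ 2 by positivity)
    (show 0 < α / q * ∫ x in Ω, |ψ x| ^ q by positivity) (sub_pos.2 hvE)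
  refine ((Set.Ioo_infinite hc₀₁).image
    (hv.toL2_sub_const_mul_injective hψ hψne).injOn).mono ?_
  rintro _ ⟨c, hcmem, rfl⟩
  have hcpos : 0 < c := hc₀.trans hcmem.1
  obtain ⟨hpos, hsmall⟩ := hc c hcmem
  rw [← smoothEnergy_const_mul hcpos.le hψ] at hpos hsmall
  have hw := hψ.const_mul c
  have hw0 : ∀ x, 0 ≤ c * ψ x := fun x => mul_nonneg hcpos.le (hψ0 x)
  have hd : Disjoint (tsupport v) (tsupport fun x => c * ψ x) :=
    hdisj.mono_right tsupport_mul_subset_right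
  have hsum := smoothEnergy_sub_of_disjoint hq0 α hv hw hd
  have hΛ1 := Lambda1_le_energy hN hΩb hq1 hq2 hα (hv.toL2_mem_W012 hΩo)
  rw [hv.energy_toL2 hΩo] at hΛ1
  -- Nonvanishing of both parts is read off from their nonzero energies.
  have hne : ∀ {f} (hf : IsTestFunction Ω f), smoothEnergy Ω q α f ≠ 0 → hf.toL2 ≠ 0 :=
    fun hf h h0 => h (by rw [← hf.energy_toL2 hΩo, h0, energy_zero hΩo hq0.ne'])
  have hneg := hv.negPart_toL2_sub hw hv0 hw0 hd
  refine ⟨(hv.sub hw).toL2_mem_W012 hΩo, ⟨?_, ?_⟩, ?_, ?_, ?_, ?_⟩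
  · rw [hv.posPart_toL2_sub hw hv0 hw0 hd]
    exact hne hv (hvE.trans_le (Lambda2_nonpos hN hΩo hΩb hΩne hq1 hq2 hα)).ne
  · rw [hneg]
    exact hne hw hpos.ne'
  · rw [(hv.sub hw).energy_toL2 hΩo, hsum]
    linarith
  · rw [(hv.sub hw).energy_toL2 hΩo, hsum]
    linarith
  · rw [hneg]
    exact hw.toL2_mem_W012 hΩo
  · rw [hneg, hw.energy_toL2 hΩo]
    exact hpos.le
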